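/- Let $d\ge 1$ and call a non-increasing sequence $\lambda=(\lambda_1,\dots,\lambda_d)$ of non-negative integers a partition of length $d$ (zero entries are allowed). For such $\lambda$ let $V_d^\lambda$ be the finite-dimensional irreducible module of highest weight $\lambda$ over the Lie algebra $gl_d$ of complex $d\times d$ matrices, relative to the Borel subalgebra of upper triangular matrices. For partitions $\lambda,\mu,\nu$ of length $d$ let the Littlewood–Richardson coefficient $C_{\lambda\mu}^{\nu}$ be the multiplicity of $V_d^\nu$ in $V_d^\lambda\otimes V_d^\mu$, i.e. $C_{\lambda\mu}^{\nu}=\dim\operatorname{Hom}_{gl_d}(V_d^\nu,V_d^\lambda\otimes V_d^\mu)$. Let $\lambda,\mu,\nu$ be partitions of length $d$. If $\nu_m>\min\{\mu_m+\lambda_1,\ \lambda_m+\mu_1\}$ for some $m\in\{1,2,\dots,d\}$, then $C_{\lambda\mu}^{\nu}=0$. -/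

import Mathlib

open scoped TensorProduct

namespace LRGl

/-- The Lie algebra of all complex `d × d` matrices, with bracket `⁅X, Y⁆ = X * Y - Y * X`. -/
abbrev gl (d : ℕ) : Type := Matrix (Fin d) (Fin d) ℂ

instance glLieRing (d : ℕ) : LieRing (gl d) := LieRing.ofAssociativeRing

instance glLieAlgebra (d : ℕ) : LieAlgebra ℂ (gl d) := LieAlgebra.ofAssociativeAlgebra

/-- The elementary matrix with `1` in row `i` and column `j` and `0` elsewhere. -/
abbrev e {d : ℕ} (i j : Fin d) : gl d := Matrix.single i j (1 : ℂ)

/-- A partition of length `d`: a non-increasing sequence of `d` non-negative integers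
(zero entries are allowed). -/
structure Part (d : ℕ) where
  parts : Fin d → ℕ
  anti : Antitone parts

instance (d : ℕ) : CoeFun (Part d) (fun _ => Fin d → ℕ) := ⟨Part.parts⟩

/-- The non-zero vector `v` is a highest weight vector of weight `w`, relative to the standard
Borel subalgebra of upper triangular matrices: it is killed by `e i j` for `i < j`, and `e i i`
acts on it by the scalar `w i`. -/
def IsHighestWeightVector {d : ℕ} {V : Type*} [AddCommGroup V] [Module ℂ V]
    [LieRingModule (gl d) V] (w : Fin d → ℕ) (v : V) : Prop :=
  v ≠ 0 ∧ (∀ i j : Fin d, i < j → ⁅e i j, v⁆ = 0) ∧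
    ∀ i : Fin d, ⁅e i i, v⁆ = (w i : ℂ) • v

/-- A finite-dimensional irreducible `gl d`-module with highest weight `w`. -/
structure HighestWeightIrrep (d : ℕ) (w : Fin d → ℕ) where
  V : Type
  [addCommGroup : AddCommGroup V]
  [module : Module ℂ V]
  [lieRingModule : LieRingModule (gl d) V]
  [lieModule : LieModule ℂ (gl d) V]
  finiteDimensional : FiniteDimensional ℂ V
  irreducible : LieModule.IsIrreducible ℂ (gl d) V
  exists_highestWeightVector : ∃ v : V, IsHighestWeightVector w v

/-! ### Existence of the irreducible module with a given highest weight

Inside the polynomial functions in variables `x i a`, products of leading minors are highest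
weight vectors. The irreducible module is a quotient of the submodule that such a vector
generates. -/

section Existence

variable {d : ℕ}

abbrev Poly (d : ℕ) : Type := MvPolynomial (Fin d × Fin d) ℂ

/-- The action of a matrix on polynomials by derivations, `x j a ↦ ∑ k, X k j * x k a`. -/
noncomputable def der (X : gl d) : Derivation ℂ (Poly d) (Poly d) :=
  MvPolynomial.mkDerivation ℂ
    (fun p => ∑ k, MvPolynomial.C (X k p.1) * MvPolynomial.X (k, p.2))

lemma der_X (X : gl d) (j a : Fin d) :
    der X (MvPolynomial.X (j, a)) =
      ∑ k, MvPolynomial.C (X k j) * MvPolynomial.X (k, a) := by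
  simp [der, MvPolynomial.mkDerivation_X]

lemma der_e_X (i j l a : Fin d) :
    der (e i j) (MvPolynomial.X (l, a)) = if j = l then MvPolynomial.X (i, a) else 0 := by
  rw [der_X, Finset.sum_eq_single i]
  · by_cases h : j = l <;> simp [h]
  · intro b _ hb
    simp [Ne.symm hb]
  · simp

noncomputable def derHom (d : ℕ) : gl d →ₗ⁅ℂ⁆ Derivation ℂ (Poly d) (Poly d) where
  toFun := der
  map_add' X Y := by
    apply MvPolynomial.derivation_ext
    rintro ⟨j, a⟩
    simp [der_X, add_mul, Finset.sum_add_distrib]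
  map_smul' c X := by
    apply MvPolynomial.derivation_ext
    rintro ⟨j, a⟩
    simp [der_X, Finset.smul_sum, MvPolynomial.smul_eq_C_mul, mul_assoc]
  map_lie' := by
    intro X Y
    apply MvPolynomial.derivation_ext
    rintro ⟨j, a⟩
    have key : ∀ A B : gl d, der A (der B (MvPolynomial.X (j, a))) =
        ∑ k, MvPolynomial.C ((A * B) k j) * MvPolynomial.X (k, a) := by
      intro A B
      rw [der_X, map_sum]
      simp only [Derivation.leibniz, der_X, smul_eq_mul, MvPolynomial.derivation_C, mul_zero,
        add_zero, Finset.mul_sum, Matrix.mul_apply, map_sum, map_mul, Finset.sum_mul]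
      rw [Finset.sum_comm]
      refine Finset.sum_congr rfl fun k _ => Finset.sum_congr rfl fun l _ => ?_
      ring
    rw [Derivation.commutator_apply, key, key, der_X, ← Finset.sum_sub_distrib]
    refine Finset.sum_congr rfl fun k _ => ?_
    rw [← sub_mul, ← map_sub]
    rfl

noncomputable instance polyLieRingModule : LieRingModule (gl d) (Poly d) :=
  LieRingModule.compLieHom (Poly d) (derHom d)

instance polyLieModule : LieModule ℂ (gl d) (Poly d) :=
  LieModule.compLieHom (Poly d) (derHom d)

lemma lie_eq_der (X : gl d) (p : Poly d) : ⁅X, p⁆ = der X p := rfl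

lemma totalDegree_der_le (X : gl d) (p : Poly d) :
    (der X p).totalDegree ≤ p.totalDegree := by
  rw [p.as_sum, map_sum, ← p.as_sum]
  refine MvPolynomial.totalDegree_finsetSum_le fun s hs => ?_
  rw [der, MvPolynomial.mkDerivation_monomial]
  refine (MvPolynomial.totalDegree_smul_le _ _).trans ?_
  rw [Finsupp.sum]
  refine MvPolynomial.totalDegree_finsetSum_le fun i hi => ?_
  rw [smul_eq_mul]
  refine (MvPolynomial.totalDegree_mul _ _).trans ?_
  have h1 : (∑ k, MvPolynomial.C (X k i.1) * MvPolynomial.X (k, i.2) : Poly d).totalDegree ≤ 1 := by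
    refine MvPolynomial.totalDegree_finsetSum_le fun k _ => ?_
    refine (MvPolynomial.totalDegree_mul _ _).trans ?_
    simp
  have h2 : (MvPolynomial.monomial (s - Finsupp.single i 1) ((s i : ℕ) : ℂ)).totalDegree + 1
      ≤ p.totalDegree := by
    refine le_trans ?_ (MvPolynomial.le_totalDegree hs)
    have h3 := MvPolynomial.totalDegree_monomial_le (R := ℂ) (s - Finsupp.single i 1) ((s i : ℕ) : ℂ)
    have hsi : 1 ≤ s i := Nat.one_le_iff_ne_zero.mpr (Finsupp.mem_support_iff.mp hi)
    have h4 : (s.sum fun _ n => n) = ((s - Finsupp.single i 1).sum fun _ n => n) + 1 := by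
      conv_lhs => rw [← tsub_add_cancel_of_le (Finsupp.single_le_iff.mpr hsi)]
      rw [Finsupp.sum_add_index' (fun _ => rfl) (fun _ _ _ => rfl)]
      simp
    rw [h4]
    exact Nat.add_le_add_right h3 1
  omega

/-- `p` is a highest weight vector of weight `w`, normalised by its value at the identity. -/
def IsSing (w : Fin d → ℕ) (p : Poly d) : Prop :=
  (∀ i j : Fin d, i < j → der (e i j) p = 0) ∧ (∀ i : Fin d, der (e i i) p = (w i : ℂ) • p) ∧
    MvPolynomial.eval (fun q : Fin d × Fin d => if q.1 = q.2 then (1 : ℂ) else 0) p = 1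

lemma IsSing.one : IsSing (fun _ : Fin d => 0) 1 := by
  refine ⟨fun i j _ => ?_, fun i => ?_, ?_⟩ <;> simp

lemma IsSing.mul {w w' : Fin d → ℕ} {p q : Poly d} (hp : IsSing w p) (hq : IsSing w' q) :
    IsSing (fun i => w i + w' i) (p * q) := by
  refine ⟨fun i j h => ?_, fun i => ?_, ?_⟩
  · simp [Derivation.leibniz, hp.1 i j h, hq.1 i j h]
  · rw [Derivation.leibniz, hp.2.1, hq.2.1]
    simp only [smul_eq_mul, MvPolynomial.smul_eq_C_mul, Nat.cast_add, map_add]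
    ring
  · simp [hp.2.2, hq.2.2]

lemma der_prod_zero {ι : Type*} (D : Derivation ℂ (Poly d) (Poly d)) (s : Finset ι)
    (f : ι → Poly d) (h : ∀ i ∈ s, D (f i) = 0) : D (∏ i ∈ s, f i) = 0 := by
  classical
  induction s using Finset.induction_on with
  | empty => simp
  | insert a s ha ih =>
    rw [Finset.prod_insert ha, Derivation.leibniz, h a (Finset.mem_insert_self a s),
      ih fun i hi => h i (Finset.mem_insert_of_mem hi)]
    simp

lemma der_det_zero {ι : Type*} [Fintype ι] [DecidableEq ι] (D : Derivation ℂ (Poly d) (Poly d))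
    (M : Matrix ι ι (Poly d)) (h : ∀ i j, D (M i j) = 0) : D M.det = 0 := by
  rw [Matrix.det_apply, map_sum]
  refine Finset.sum_eq_zero fun σ _ => ?_
  have h0 : D (∏ i, M (σ i) i) = 0 := der_prod_zero D _ _ fun i _ => h _ _
  rw [Units.smul_def, map_zsmul, h0, smul_zero]

/-- The principal minor on the rows and columns in `S`. -/
noncomputable def minorMat (S : Fin d → Prop) : Matrix {i // S i} {i // S i} (Poly d) :=
  Matrix.of fun i a => MvPolynomial.X (i.1, a.1)

lemma IsSing.minor (S : Fin d → Prop) [DecidablePred S] (hS : ∀ i j, i ≤ j → S j → S i) :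
    IsSing (fun i => if S i then 1 else 0) (minorMat S).det := by
  have key : ∀ i j : Fin d, i ≤ j → der (e i j) (minorMat S).det =
      if i = j ∧ S j then (minorMat S).det else 0 := by
    intro i j hij
    by_cases hj : S j
    · have hi : S i := hS i j hij hj
      have hadj : ∀ a, der (e i j) ((minorMat S).adjugate a ⟨j, hj⟩) = 0 := by
        intro a
        rw [Matrix.adjugate_apply]
        refine der_det_zero _ _ fun r c => ?_
        by_cases hr : r = ⟨j, hj⟩
        · subst hr
          rw [Matrix.updateRow_self, Pi.single_apply]
          split_ifs <;> simp
        · rw [Matrix.updateRow_ne hr, minorMat, Matrix.of_apply, der_e_X, if_neg]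
          intro h
          exact hr (Subtype.ext h.symm)
      have h1 : der (e i j) (minorMat S).det =
          (minorMat S * (minorMat S).adjugate) ⟨i, hi⟩ ⟨j, hj⟩ := by
        conv_lhs => rw [Matrix.det_eq_sum_mul_adjugate_row _ ⟨j, hj⟩]
        rw [map_sum, Matrix.mul_apply]
        refine Finset.sum_congr rfl fun a _ => ?_
        rw [Derivation.leibniz, hadj, smul_zero, zero_add, minorMat, Matrix.of_apply, der_e_X,
          if_pos rfl, smul_eq_mul, mul_comm]
        rfl
      rw [h1, Matrix.mul_adjugate, Matrix.smul_apply, Matrix.one_apply]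
      by_cases h : i = j <;> simp [h, hj]
    · rw [if_neg (fun h => hj h.2)]
      refine der_det_zero _ _ fun r c => ?_
      rw [minorMat, Matrix.of_apply, der_e_X, if_neg]
      intro h
      exact hj (h ▸ r.2)
  refine ⟨fun i j h => ?_, fun i => ?_, ?_⟩
  · rw [key i j h.le, if_neg fun h' => h.ne h'.1]
  · rw [key i i le_rfl]
    by_cases h : S i <;> simp [h]
  · rw [RingHom.map_det]
    convert Matrix.det_one (n := {i // S i}) (R := ℂ)
    ext r c
    simp [minorMat, Matrix.one_apply, Subtype.ext_iff]

lemma exists_isSing (w : Part d) : ∃ p : Poly d, IsSing w p := by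
  have h : ∀ N : ℕ, ∃ p : Poly d, IsSing (fun i => min (w i) N) p := by
    intro N
    induction N with
    | zero => exact ⟨1, by simpa using IsSing.one⟩
    | succ N ih =>
      obtain ⟨p, hp⟩ := ih
      refine ⟨p * (minorMat fun i => N < w i).det, ?_⟩
      convert hp.mul (IsSing.minor (fun i => N < w i)
        fun i j hij hj => lt_of_lt_of_le hj (w.anti hij)) using 2 with i
      split_ifs <;> omega
  obtain ⟨p, hp⟩ := h (∑ i, w i)
  refine ⟨p, ?_⟩
  convert hp using 2 with i
  exact (min_eq_left (Finset.single_le_sum (f := w.parts) (fun _ _ => Nat.zero_le _)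
    (Finset.mem_univ i))).symm

/-- For every partition, a finite-dimensional irreducible module with that highest weight
exists. -/
theorem nonempty_highestWeightIrrep (w : Part d) : Nonempty (HighestWeightIrrep d w) := by
  obtain ⟨p, hp1, hp2, hp3⟩ := exists_isSing w
  have hp0 : p ≠ 0 := by
    rintro rfl
    simp at hp3
  let W : LieSubmodule ℂ (gl d) (Poly d) :=
    { MvPolynomial.restrictTotalDegree (Fin d × Fin d) ℂ p.totalDegree with
      lie_mem := by
        intro X q hq
        have hq' : q.totalDegree ≤ p.totalDegree :=
          (MvPolynomial.mem_restrictTotalDegree _ _ _).mp hq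
        exact (MvPolynomial.mem_restrictTotalDegree _ _ _).mpr
          ((totalDegree_der_le X q).trans hq') }
  let N : LieSubmodule ℂ (gl d) (Poly d) := LieSubmodule.lieSpan ℂ (gl d) {p}
  have hpN : p ∈ N := LieSubmodule.subset_lieSpan rfl
  have hNW : N ≤ W := by
    rw [LieSubmodule.lieSpan_le, Set.singleton_subset_iff]
    exact (MvPolynomial.mem_restrictTotalDegree _ _ _).mpr le_rfl
  have hWfin : FiniteDimensional ℂ
      (MvPolynomial.restrictTotalDegree (Fin d × Fin d) ℂ p.totalDegree) := inferInstance
  have hNfin : FiniteDimensional ℂ N :=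
    Submodule.finiteDimensional_of_le (S₁ := N.toSubmodule)
      (S₂ := MvPolynomial.restrictTotalDegree (Fin d × Fin d) ℂ p.totalDegree) hNW
  let v : N := ⟨p, hpN⟩
  have hgen : ∀ Q : LieSubmodule ℂ (gl d) N, v ∈ Q → Q = ⊤ := by
    intro Q hQ
    have h1 : N ≤ Q.map N.incl := by
      rw [LieSubmodule.lieSpan_le, Set.singleton_subset_iff]
      exact (LieSubmodule.mem_map _).mpr ⟨v, hQ, rfl⟩
    rw [eq_top_iff]
    intro x _
    obtain ⟨y, hy, hyx⟩ := (LieSubmodule.mem_map _).mp (h1 x.2)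
    have : y = x := Subtype.ext hyx
    exact this ▸ hy
  have hv0 : v ≠ 0 := fun h => hp0 (congrArg Subtype.val h)
  have hbot : (⊥ : LieSubmodule ℂ (gl d) N) ≠ ⊤ := by
    intro h
    have : v ∈ (⊥ : LieSubmodule ℂ (gl d) N) := h ▸ LieSubmodule.mem_top v
    exact hv0 ((LieSubmodule.mem_bot v).mp this)
  obtain ⟨P, hP, -⟩ := (eq_top_or_exists_le_coatom (⊥ : LieSubmodule ℂ (gl d) N)).resolve_left hbot
  have hvP : v ∉ P := fun h => hP.1 (hgen P h)
  have hv' : LieSubmodule.Quotient.mk' P v ≠ 0 := fun h =>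
    hvP ((LieSubmodule.Quotient.mk_eq_zero _).mp h)
  have : Nontrivial (N ⧸ P) := ⟨⟨_, _, hv'⟩⟩
  refine ⟨{ V := N ⧸ P, finiteDimensional := ?_, irreducible := ?_,
            exists_highestWeightVector := ⟨LieSubmodule.Quotient.mk' P v, hv', ?_, ?_⟩ }⟩
  · exact inferInstanceAs (FiniteDimensional ℂ (N ⧸ P.toSubmodule))
  · refine LieModule.IsIrreducible.mk fun Q hQ => ?_
    have hle : P ≤ Q.comap (LieSubmodule.Quotient.mk' P) := by
      intro x hx
      rw [LieSubmodule.mem_comap, (LieSubmodule.Quotient.mk_eq_zero _).mpr hx]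
      exact Q.zero_mem
    have hne : P ≠ Q.comap (LieSubmodule.Quotient.mk' P) := by
      intro h
      apply hQ
      rw [eq_bot_iff]
      intro y hy
      obtain ⟨x, rfl⟩ := LieSubmodule.Quotient.surjective_mk' P y
      have : x ∈ P := by
        rw [h]
        exact hy
      rw [LieSubmodule.mem_bot]
      exact (LieSubmodule.Quotient.mk_eq_zero _).mpr this
    have htop := hP.2 _ (lt_of_le_of_ne hle hne)
    rw [eq_top_iff]
    intro y _
    obtain ⟨x, rfl⟩ := LieSubmodule.Quotient.surjective_mk' P y
    have hx : x ∈ Q.comap (LieSubmodule.Quotient.mk' P) := htop ▸ LieSubmodule.mem_top x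
    exact hx
  · intro i j hij
    have : ⁅e i j, v⁆ = 0 := Subtype.ext (hp1 i j hij)
    rw [← LieModuleHom.map_lie, this, map_zero]
  · intro i
    have : ⁅e i i, v⁆ = ((w i : ℕ) : ℂ) • v := Subtype.ext (hp2 i)
    rw [← LieModuleHom.map_lie, this, map_smul]

end Existence

/-- The finite-dimensional irreducible `gl d`-module with highest weight `w`
(it is unique up to isomorphism). -/
noncomputable def irrep {d : ℕ} (w : Part d) : HighestWeightIrrep d w :=
  Classical.choice (nonempty_highestWeightIrrep w)

/-- The underlying space of the irreducible `gl d`-module with highest weight `w`. -/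
abbrev V {d : ℕ} (w : Part d) : Type := (irrep w).V

noncomputable instance {d : ℕ} (w : Part d) : AddCommGroup (V w) := (irrep w).addCommGroup

noncomputable instance {d : ℕ} (w : Part d) : Module ℂ (V w) := (irrep w).module

noncomputable instance {d : ℕ} (w : Part d) : LieRingModule (gl d) (V w) :=
  (irrep w).lieRingModule

instance {d : ℕ} (w : Part d) : LieModule ℂ (gl d) (V w) := (irrep w).lieModule

instance {d : ℕ} (w : Part d) : FiniteDimensional ℂ (V w) := (irrep w).finiteDimensional

instance {d : ℕ} (w : Part d) : LieModule.IsIrreducible ℂ (gl d) (V w) := (irrep w).irreducible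

/-- The Littlewood-Richardson coefficient: the multiplicity of the irreducible module `V nu` in
the tensor product `V lam ⊗ V mu`, that is, the dimension of the space of `gl d`-module
homomorphisms from `V nu` to `V lam ⊗ V mu` (all spaces here are finite-dimensional). -/
noncomputable def lrCoeff {d : ℕ} (lam mu nu : Part d) : ℕ :=
  Module.finrank ℂ (V nu →ₗ⁅ℂ, gl d⁆ V lam ⊗[ℂ] V mu)

end LRGl

/-!
Suppose `V nu` maps non-trivially to `V lam ⊗ V mu`. The image of a highest weight vector is a
non-zero singular vector `t` of weight `nu` in `V lam ⊗ V mu`. Let `φ` be a linear functional on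
`V mu` that spans the line dual to the highest weight line: it vanishes on all other weight spaces.
The contraction of `t` with `φ` is a vector of weight `nu - mu` in `V lam`. It is non-zero, because
the functionals whose contraction with `t` vanishes form a subspace stable under the raising
operators, and such a subspace is everything as soon as it contains `φ`
(`contract_ne_zero`). Hence `nu m - mu m` is an eigenvalue of `e m m` on `V lam`.

It remains to bound the eigenvalues of `e m m` on `V lam` by `lam 0`. For `m = 0` this holds
because `V lam` is spanned by the vectors obtained from a highest weight vector by lowering
operators, and these never raise the eigenvalue of `e 0 0` (`eigenvalue_first`). For general `m`,
take an eigenvalue of `e m m` with largest real part; its eigenspace contains a primitive vector for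
the `sl₂`-triple `(e m m - e 0 0, e m 0, e 0 m)`, and the last vector of the `sl₂`-string through
it shows that the same number is an eigenvalue of `e 0 0` (`re_eigenvalue_le`).

This gives `nu m ≤ mu m + lam 0`; the inequality `nu m ≤ lam m + mu 0` follows by exchanging the
two tensor factors.
-/

namespace LRGl

section Generation

/-! ### Subspaces stable under a set of operators -/

variable {L M : Type*} [LieRing L] [AddCommGroup M] [Module ℂ M] [LieRingModule L M]

/-- The smallest subspace containing `x` and stable under the action of every element of `s`. -/
def stableSpan (s : Set L) (x : M) : Submodule ℂ M :=
  sInf {P | x ∈ P ∧ ∀ F ∈ s, ∀ y ∈ P, ⁅F, y⁆ ∈ P}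

lemma mem_stableSpan_self (s : Set L) (x : M) : x ∈ stableSpan s x :=
  Submodule.mem_sInf.mpr fun _ hP => hP.1

lemma lie_mem_stableSpan {s : Set L} {x y : M} {F : L} (hF : F ∈ s) (hy : y ∈ stableSpan s x) :
    ⁅F, y⁆ ∈ stableSpan s x :=
  Submodule.mem_sInf.mpr fun P hP => hP.2 F hF y (Submodule.mem_sInf.mp hy P hP)

lemma stableSpan_le {s : Set L} {x : M} {P : Submodule ℂ M} (hx : x ∈ P)
    (h : ∀ F ∈ s, ∀ y ∈ P, ⁅F, y⁆ ∈ P) : stableSpan s x ≤ P :=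
  sInf_le ⟨hx, h⟩

variable [LieAlgebra ℂ L] [LieModule ℂ L M]

/-- If the whole Lie algebra maps the generator into `stableSpan s x`, then `stableSpan s x` is a
submodule: the vectors that the Lie algebra maps into it are stable under `s`, since
`⁅X, ⁅F, y⁆⁆ = ⁅⁅X, F⁆, y⁆ + ⁅F, ⁅X, y⁆⁆`. -/
lemma lie_mem_stableSpan_of_generator {s : Set L} {x : M}
    (hx : ∀ X : L, ⁅X, x⁆ ∈ stableSpan s x) (X : L) {y : M} (hy : y ∈ stableSpan s x) :
    ⁅X, y⁆ ∈ stableSpan s x := by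
  let P : Submodule ℂ M :=
    { carrier := {y | y ∈ stableSpan s x ∧ ∀ X : L, ⁅X, y⁆ ∈ stableSpan s x}
      zero_mem' := ⟨zero_mem _, fun X => by simp⟩
      add_mem' := fun ha hb =>
        ⟨add_mem ha.1 hb.1, fun X => by rw [lie_add]; exact add_mem (ha.2 X) (hb.2 X)⟩
      smul_mem' := fun c a ha =>
        ⟨Submodule.smul_mem _ c ha.1, fun X => by
          rw [lie_smul]; exact Submodule.smul_mem _ c (ha.2 X)⟩ }
  have hle : stableSpan s x ≤ P := by
    refine stableSpan_le ⟨mem_stableSpan_self s x, hx⟩ fun F hF y hy => ⟨hy.2 F, fun X => ?_⟩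
    rw [leibniz_lie]
    exact add_mem (hy.2 _) (lie_mem_stableSpan hF (hy.2 X))
  exact (hle hy).2 X

end Generation

variable {d : ℕ}

/-- The elementary matrices strictly below the diagonal. -/
def lowering (d : ℕ) : Set (gl d) := {F | ∃ i j : Fin d, j < i ∧ F = e i j}

/-- The elementary matrices strictly above the diagonal. -/
def raising (d : ℕ) : Set (gl d) := {F | ∃ i j : Fin d, i < j ∧ F = e i j}

section Modules

variable {M : Type*} [AddCommGroup M] [Module ℂ M] [LieRingModule (gl d) M]
  [LieModule ℂ (gl d) M]

lemma lie_mem_of_forall_e {P : Submodule ℂ M} {y : M} (h : ∀ i j : Fin d, ⁅e i j, y⁆ ∈ P)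
    (X : gl d) : ⁅X, y⁆ ∈ P := by
  induction X using Matrix.induction_on' with
  | h_zero => simp
  | h_add p q hp hq => rw [add_lie]; exact add_mem hp hq
  | h_std_basis i j c =>
    have : (Matrix.single i j c : gl d) = c • e i j := by simp
    rw [this, smul_lie]
    exact P.smul_mem c (h i j)

lemma IsHighestWeightVector.stableSpan_lowering_eq_top [LieModule.IsIrreducible ℂ (gl d) M]
    {w : Fin d → ℕ} {x : M} (hx : IsHighestWeightVector w x) :
    stableSpan (lowering d) x = ⊤ := by
  have hgen : ∀ X : gl d, ⁅X, x⁆ ∈ stableSpan (lowering d) x := by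
    refine lie_mem_of_forall_e fun i j => ?_
    rcases lt_trichotomy i j with hij | rfl | hij
    · rw [hx.2.1 i j hij]; exact zero_mem _
    · rw [hx.2.2]; exact Submodule.smul_mem _ _ (mem_stableSpan_self _ _)
    · exact lie_mem_stableSpan ⟨i, j, hij, rfl⟩ (mem_stableSpan_self _ _)
  let N : LieSubmodule ℂ (gl d) M :=
    { stableSpan (lowering d) x with
      lie_mem := fun {X _} hy => lie_mem_stableSpan_of_generator hgen X hy }
  have hxN : x ∈ N := mem_stableSpan_self _ _
  have hN : N = ⊤ := (IsSimpleOrder.eq_bot_or_eq_top N).resolve_left fun h =>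
    hx.1 ((LieSubmodule.mem_bot x).mp (h ▸ hxN))
  rw [eq_top_iff]
  intro y _
  have : y ∈ N := hN ▸ LieSubmodule.mem_top y
  exact this

/-! ### Eigenspaces of diagonal matrices -/

lemma diagonal_lie_e (t : Fin d → ℂ) (i j : Fin d) :
    ⁅(Matrix.diagonal t : gl d), e i j⁆ = (t i - t j) • e i j := by
  rw [Ring.lie_def]
  ext k l
  simp only [Matrix.sub_apply, Matrix.diagonal_mul, Matrix.mul_diagonal, Matrix.smul_apply,
    Matrix.single_apply, smul_eq_mul]
  split_ifs with h
  · rw [h.1, h.2]; ring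
  · simp

lemma e_diag_eq (i : Fin d) : (e i i : gl d) = Matrix.diagonal (Pi.single i 1) := by
  rw [Matrix.diagonal_single]

/-- The eigenspace of `X` acting on `M`, for the eigenvalue `c`. -/
abbrev eig (M : Type*) [AddCommGroup M] [Module ℂ M] [LieRingModule (gl d) M]
    [LieModule ℂ (gl d) M] (X : gl d) (c : ℂ) : Submodule ℂ M :=
  (LieModule.toEnd ℂ (gl d) M X).eigenspace c

lemma mem_eig {X : gl d} {c : ℂ} {y : M} : y ∈ eig M X c ↔ ⁅X, y⁆ = c • y := by
  rw [Module.End.mem_eigenspace_iff, LieModule.toEnd_apply_apply]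

lemma e_lie_mem_eig {t : Fin d → ℂ} {c c' : ℂ} {i j : Fin d} (h : c' = c + (t i - t j)) {y : M}
    (hy : y ∈ eig M (Matrix.diagonal t) c) : ⁅e i j, y⁆ ∈ eig M (Matrix.diagonal t) c' := by
  rw [mem_eig] at hy ⊢
  rw [leibniz_lie, hy, diagonal_lie_e, lie_smul, smul_lie, h]
  module

lemma IsHighestWeightVector.mem_eig {w : Fin d → ℕ} {x : M} (hx : IsHighestWeightVector w x)
    (t : Fin d → ℂ) : x ∈ eig M (Matrix.diagonal t) (∑ i, t i * w i) := by
  have h : (Matrix.diagonal t : gl d) = ∑ i, t i • e i i := by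
    ext k l
    simp [Matrix.sum_apply, Matrix.single_apply, Matrix.diagonal_apply, ite_and]
  rw [LRGl.mem_eig, h, sum_lie, Finset.sum_smul]
  refine Finset.sum_congr rfl fun i _ => ?_
  rw [smul_lie, hx.2.2, smul_smul]

/-- On an irreducible module of highest weight `w`, the eigenvalues of `e 0 0` are at most `w 0`:
lowering operators never raise them. -/
lemma IsHighestWeightVector.eigenvalue_first [LieModule.IsIrreducible ℂ (gl d) M]
    {w : Fin d → ℕ} {x : M} (hx : IsHighestWeightVector w x) (o : Fin d) (ho : ∀ i, o ≤ i)
    {c : ℂ} (hc : eig M (e o o) c ≠ ⊥) : ∃ n : ℕ, c = w o - n := by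
  by_contra! hcon
  have htop : ⨆ n : ℕ, eig M (e o o) (w o - n) = ⊤ := by
    rw [eq_top_iff, ← hx.stableSpan_lowering_eq_top]
    refine stableSpan_le ?_ ?_
    · refine Submodule.mem_iSup_of_mem 0 ?_
      rw [LRGl.mem_eig, hx.2.2]
      simp
    · rintro F ⟨i, j, hij, rfl⟩ y hy
      induction hy using Submodule.iSup_induction' with
      | mem n y hy =>
        rw [e_diag_eq] at hy
        have hi : i ≠ o := ((ho j).trans_lt hij).ne'
        by_cases hj : j = o
        · refine Submodule.mem_iSup_of_mem (n + 1) ?_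
          rw [e_diag_eq]
          refine e_lie_mem_eig ?_ hy
          simp [hi, hj]
          ring
        · refine Submodule.mem_iSup_of_mem n ?_
          rw [e_diag_eq]
          refine e_lie_mem_eig ?_ hy
          simp [hi, hj]
      | zero => simp
      | add y z _ _ hy hz => rw [lie_add]; exact add_mem hy hz
  have hdis := Module.End.eigenspaces_iSupIndep (LieModule.toEnd ℂ (gl d) M (e o o)) c
  have hle : (⊤ : Submodule ℂ M) ≤ ⨆ c', ⨆ (_ : c' ≠ c), eig M (e o o) c' := by
    rw [← htop]
    exact iSup_le fun n => le_iSup₂_of_le (w o - n : ℂ) (hcon n).symm le_rfl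
  exact hc (disjoint_top.mp (hdis.mono_right hle))

/-- Every eigenvalue of `e m m` is bounded, in real part, by an eigenvalue of `e o o`: reflect a
primitive vector of the `sl₂` attached to `m` and `o` to the other end of its string. -/
lemma exists_eigenvalue_re_le [FiniteDimensional ℂ M] (o m : Fin d) {c : ℂ}
    (hc : eig M (e m m) c ≠ ⊥) : ∃ c' : ℂ, eig M (e o o) c' ≠ ⊥ ∧ c.re ≤ c'.re := by
  rcases eq_or_ne m o with rfl | hmo
  · exact ⟨c, hc, le_rfl⟩
  obtain ⟨c', hc', hmax⟩ := Set.exists_max_image {z : ℂ | eig M (e m m) z ≠ ⊥} Complex.re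
    (Module.End.finite_hasEigenvalue (LieModule.toEnd ℂ (gl d) M (e m m))) ⟨c, hc⟩
  refine ⟨c', ?_, hmax c hc⟩
  -- A common eigenvector of the commuting operators `e m m` and `e o o`.
  obtain ⟨x, κ, hx0, hxm, hxo⟩ : ∃ (x : M) (κ : ℂ), x ≠ 0 ∧ ⁅e m m, x⁆ = c' • x ∧
      ⁅e o o, x⁆ = κ • x := by
    have hmaps : ∀ y ∈ eig M (e m m) c', LieModule.toEnd ℂ (gl d) M (e o o) y ∈
        eig M (e m m) c' := by
      intro y hy
      rw [LieModule.toEnd_apply_apply]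
      rw [e_diag_eq m] at hy ⊢
      exact e_lie_mem_eig (by simp) hy
    have : Nontrivial (eig M (e m m) c') := Submodule.nontrivial_iff_ne_bot.mpr hc'
    obtain ⟨κ, hκ⟩ := Module.End.exists_eigenvalue
      ((LieModule.toEnd ℂ (gl d) M (e o o)).restrict hmaps)
    obtain ⟨y, hy⟩ := hκ.exists_hasEigenvector
    refine ⟨y, κ, fun h => hy.2 (Subtype.ext h), mem_eig.mp y.2, ?_⟩
    exact congrArg Subtype.val hy.apply_eq_smul
  -- By maximality of `c'`, the operator `e m o` kills `x`.
  have hE : ⁅e m o, x⁆ = 0 := by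
    by_contra hne
    have hmem : ⁅e m o, x⁆ ∈ eig M (e m m) (c' + 1) := by
      have hx := mem_eig.mpr hxm
      rw [e_diag_eq] at hx ⊢
      exact e_lie_mem_eig (by simp [hmo.symm]) hx
    have := hmax (c' + 1) ((Submodule.ne_bot_iff _).mpr ⟨_, hmem, hne⟩)
    simp at this
    linarith
  have ht : IsSl2Triple (e m m - e o o : gl d) (e m o) (e o m) := by
    refine ⟨fun h => ?_, ?_, ?_, ?_⟩
    · have := congrFun (congrFun h m) m
      simp [hmo.symm] at this
    · rw [Ring.lie_def]
      simp
    · rw [sub_lie, e_diag_eq, e_diag_eq, diagonal_lie_e, diagonal_lie_e]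
      simp [hmo, hmo.symm, ← two_smul ℕ]
    · rw [sub_lie, e_diag_eq, e_diag_eq, diagonal_lie_e, diagonal_lie_e]
      simp [hmo, hmo.symm, two_smul]
      abel
  have hprim : ht.HasPrimitiveVectorWith x (c' - κ) :=
    ⟨hx0, by rw [sub_lie, hxm, hxo, sub_smul], hE⟩
  obtain ⟨n, hn⟩ := hprim.exists_nat
  have hpow : ∀ k : ℕ, (LieModule.toEnd ℂ (gl d) M (e o m) ^ k) x ∈ eig M (e o o) (κ + k) := by
    intro k
    induction k with
    | zero => simpa using mem_eig.mpr hxo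
    | succ k ih =>
      rw [pow_succ', Module.End.mul_apply, LieModule.toEnd_apply_apply]
      rw [e_diag_eq] at ih ⊢
      refine e_lie_mem_eig ?_ ih
      simp [hmo]
      ring
  refine (Submodule.ne_bot_iff _).mpr ⟨_, ?_, hprim.pow_toEnd_f_ne_zero_of_eq_nat hn le_rfl⟩
  have := hpow n
  rwa [← hn, add_sub_cancel] at this

lemma IsHighestWeightVector.re_eigenvalue_le [FiniteDimensional ℂ M]
    [LieModule.IsIrreducible ℂ (gl d) M] {w : Fin d → ℕ} {x : M}
    (hx : IsHighestWeightVector w x) (o : Fin d) (ho : ∀ i, o ≤ i) (m : Fin d)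
    {c : ℂ} (hc : eig M (e m m) c ≠ ⊥) : c.re ≤ w o := by
  obtain ⟨c', hc', hle⟩ := exists_eigenvalue_re_le o m hc
  obtain ⟨n, rfl⟩ := hx.eigenvalue_first o ho hc'
  refine hle.trans ?_
  simp

/-! ### The functional dual to the highest weight line -/

/-- On an irreducible module of highest weight `w` there is a non-zero functional of weight `-w`
killed by the lowering operators. It vanishes on the weight spaces other than the highest one;
these are collected by the eigenvalues of a diagonal matrix with strictly decreasing entries. -/
lemma IsHighestWeightVector.exists_dual [LieModule.IsIrreducible ℂ (gl d) M]
    {w : Fin d → ℕ} {x : M} (hx : IsHighestWeightVector w x) :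
    ∃ φ : Module.Dual ℂ M, φ ≠ 0 ∧ (∀ i j : Fin d, j < i → ⁅e i j, φ⁆ = 0) ∧
      ∀ i : Fin d, ⁅e i i, φ⁆ = -(w i : ℂ) • φ := by
  set t : Fin d → ℂ := fun i => -(i : ℂ) with ht
  set H : gl d := Matrix.diagonal t with hH
  set r : ℂ := ∑ i, t i * w i with hr
  set Q : Submodule ℂ M := ⨆ n : ℕ, eig M H (r - (n + 1)) with hQ
  have hxr : x ∈ eig M H r := hx.mem_eig t
  have hxQ : x ∉ Q := by
    have hle : Q ≤ ⨆ c', ⨆ (_ : c' ≠ r), eig M H c' := by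
      refine iSup_le fun n => le_iSup₂_of_le (r - (n + 1) : ℂ) ?_ le_rfl
      rw [Ne, sub_eq_self]
      exact_mod_cast n.succ_ne_zero
    have hdis := Module.End.eigenspaces_iSupIndep (LieModule.toEnd ℂ (gl d) M H) r
    exact fun h => hx.1 (Submodule.disjoint_def.mp (hdis.mono_right hle) x hxr h)
  -- A lowering operator decreases the eigenvalue of `H` by a positive integer.
  have hshift : ∀ i j : Fin d, j < i → ∃ k : ℕ, t i - t j = -((k : ℂ) + 1) := by
    intro i j hij
    obtain ⟨k, hk⟩ := Nat.exists_eq_add_of_lt (Fin.lt_def.mp hij)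
    refine ⟨k, ?_⟩
    simp only [ht, hk]
    push_cast
    ring
  have hQlow : ∀ i j : Fin d, j < i → ∀ y ∈ Q, ⁅e i j, y⁆ ∈ Q := by
    intro i j hij y hy
    obtain ⟨k, hk⟩ := hshift i j hij
    induction hy using Submodule.iSup_induction' with
    | mem n y hy =>
      refine Submodule.mem_iSup_of_mem (n + k + 1) (e_lie_mem_eig ?_ hy)
      rw [hk]
      push_cast
      ring
    | zero => simp
    | add y z _ _ hy hz => rw [lie_add]; exact add_mem hy hz
  have hQdiag : ∀ i : Fin d, ∀ y ∈ Q, ⁅e i i, y⁆ ∈ Q := by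
    intro i y hy
    induction hy using Submodule.iSup_induction' with
    | mem n y hy => exact Submodule.mem_iSup_of_mem n (e_lie_mem_eig (by simp) hy)
    | zero => simp
    | add y z _ _ hy hz => rw [lie_add]; exact add_mem hy hz
  have hxlow : ∀ i j : Fin d, j < i → ⁅e i j, x⁆ ∈ Q := by
    intro i j hij
    obtain ⟨k, hk⟩ := hshift i j hij
    refine Submodule.mem_iSup_of_mem k (e_lie_mem_eig ?_ hxr)
    rw [hk]
    ring
  have htop : (ℂ ∙ x) ⊔ Q = ⊤ := by
    rw [eq_top_iff, ← hx.stableSpan_lowering_eq_top]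
    refine stableSpan_le (Submodule.mem_sup_left (Submodule.mem_span_singleton_self x)) ?_
    rintro F ⟨i, j, hij, rfl⟩ y hy
    obtain ⟨p, hp, q, hq, rfl⟩ := Submodule.mem_sup.mp hy
    obtain ⟨a, rfl⟩ := Submodule.mem_span_singleton.mp hp
    rw [lie_add, lie_smul]
    exact Submodule.mem_sup_right
      (add_mem (Submodule.smul_mem _ _ (hxlow i j hij)) (hQlow i j hij q hq))
  obtain ⟨φ, hφx, hφQ⟩ := Submodule.exists_le_ker_of_notMem hxQ
  have hφ : ∀ q ∈ Q, φ q = 0 := fun q hq => LinearMap.mem_ker.mp (hφQ hq)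
  refine ⟨φ, fun h => hφx (by simp [h]), fun i j hij => ?_, fun i => ?_⟩
  all_goals
    refine LinearMap.ext fun y => ?_
    obtain ⟨p, hp, q, hq, rfl⟩ := Submodule.mem_sup.mp
      (htop ▸ Submodule.mem_top : y ∈ (ℂ ∙ x) ⊔ Q)
    obtain ⟨a, rfl⟩ := Submodule.mem_span_singleton.mp hp
  · simp [hφ _ (hxlow i j hij), hφ _ (hQlow i j hij q hq)]
  · simp [hφ _ (hQdiag i q hq), hφ _ hq, hx.2.2]
    ring

/-- A non-zero functional that is an eigenvector for the diagonal matrices and is killed by the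
lowering operators generates the dual of an irreducible module under the raising operators. -/
lemma stableSpan_raising_dual_eq_top [FiniteDimensional ℂ M] [LieModule.IsIrreducible ℂ (gl d) M]
    {a : Fin d → ℂ} {φ : Module.Dual ℂ M} (hφ : φ ≠ 0)
    (hlow : ∀ i j : Fin d, j < i → ⁅e i j, φ⁆ = 0) (hdiag : ∀ i : Fin d, ⁅e i i, φ⁆ = a i • φ) :
    stableSpan (raising d) φ = ⊤ := by
  set W := stableSpan (raising d) φ with hW
  have hgen : ∀ X : gl d, ⁅X, φ⁆ ∈ W := by
    refine lie_mem_of_forall_e fun i j => ?_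
    rcases lt_trichotomy i j with hij | rfl | hij
    · exact lie_mem_stableSpan ⟨i, j, hij, rfl⟩ (mem_stableSpan_self _ _)
    · rw [hdiag]; exact Submodule.smul_mem _ _ (mem_stableSpan_self _ _)
    · rw [hlow i j hij]; exact zero_mem _
  -- The common kernel of the functionals in `W` is a proper submodule of `M`.
  let N : LieSubmodule ℂ (gl d) M :=
    { W.dualCoannihilator with
      lie_mem := by
        intro X y hy
        refine (Submodule.mem_dualCoannihilator _).mpr fun ψ hψ => ?_
        have := (Submodule.mem_dualCoannihilator y).mp hy _
          (lie_mem_stableSpan_of_generator hgen X hψ)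
        rwa [Module.Dual.lie_apply, neg_eq_zero] at this }
  have hN : N = ⊥ := by
    refine (IsSimpleOrder.eq_bot_or_eq_top N).resolve_right fun h => hφ (LinearMap.ext fun y => ?_)
    have hy : y ∈ N := h ▸ LieSubmodule.mem_top y
    exact (Submodule.mem_dualCoannihilator y).mp hy φ (mem_stableSpan_self _ _)
  have hbot : W.dualCoannihilator = ⊥ := by
    rw [eq_bot_iff]
    intro y hy
    have : y ∈ N := hy
    rw [hN] at this
    exact (LieSubmodule.mem_bot y).mp this
  rw [← Subspace.dualCoannihilator_dualAnnihilator_eq (W := W), hbot,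
    Submodule.dualAnnihilator_bot]

end Modules

/-! ### Contraction of a singular vector in a tensor product -/

section Contraction

variable {M N : Type*} [AddCommGroup M] [Module ℂ M] [LieRingModule (gl d) M]
  [LieModule ℂ (gl d) M] [AddCommGroup N] [Module ℂ N] [LieRingModule (gl d) N]
  [LieModule ℂ (gl d) N]

/-- Contraction of a tensor with a functional on the second factor: `m ⊗ n ↦ φ n • m`. -/
noncomputable def contract (φ : Module.Dual ℂ N) : M ⊗[ℂ] N →ₗ[ℂ] M :=
  (TensorProduct.rid ℂ M).toLinearMap ∘ₗ φ.lTensor M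

@[simp]
lemma contract_tmul (φ : Module.Dual ℂ N) (m : M) (n : N) : contract φ (m ⊗ₜ n) = φ n • m := by
  simp [contract]

lemma contract_add (φ ψ : Module.Dual ℂ N) (t : M ⊗[ℂ] N) :
    contract (φ + ψ) t = contract φ t + contract ψ t := by
  simp [contract, LinearMap.lTensor_add]

lemma contract_smul (c : ℂ) (φ : Module.Dual ℂ N) (t : M ⊗[ℂ] N) :
    contract (c • φ) t = c • contract φ t := by
  simp [contract, LinearMap.lTensor_smul]

lemma lie_contract (X : gl d) (φ : Module.Dual ℂ N) (t : M ⊗[ℂ] N) :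
    ⁅X, contract φ t⁆ = contract φ ⁅X, t⁆ + contract ⁅X, φ⁆ t := by
  induction t using TensorProduct.induction_on with
  | zero => simp
  | tmul m n => simp
  | add s t hs ht =>
    simp only [map_add, lie_add, hs, ht]
    abel

lemma eq_zero_of_forall_contract [FiniteDimensional ℂ N] {t : M ⊗[ℂ] N}
    (h : ∀ φ : Module.Dual ℂ N, contract φ t = 0) : t = 0 := by
  let b := Module.finBasis ℂ N
  have key : ∀ s : M ⊗[ℂ] N, s = ∑ i, contract (b.coord i) s ⊗ₜ[ℂ] b i := by
    intro s
    induction s using TensorProduct.induction_on with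
    | zero => simp
    | tmul m n =>
      conv_lhs => rw [← b.sum_repr n]
      simp only [TensorProduct.tmul_sum, contract_tmul, Module.Basis.coord_apply,
        TensorProduct.smul_tmul]
    | add s t hs ht =>
      simp only [map_add, TensorProduct.add_tmul, Finset.sum_add_distrib, ← hs, ← ht]
  rw [key t]
  simp [h]

/-- The functionals whose contraction with a singular vector vanishes form a subspace stable under
the raising operators, so none of its elements generates the dual module. -/
lemma contract_ne_zero [FiniteDimensional ℂ N] {t : M ⊗[ℂ] N} (ht0 : t ≠ 0)
    (ht : ∀ i j : Fin d, i < j → ⁅e i j, t⁆ = 0) {φ : Module.Dual ℂ N}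
    (hφ : stableSpan (raising d) φ = ⊤) : contract φ t ≠ 0 := by
  intro h0
  let K : Submodule ℂ (Module.Dual ℂ N) :=
    { carrier := {ψ | contract ψ t = 0}
      zero_mem' := by simp [contract]
      add_mem' := fun {a b} (ha : contract a t = 0) (hb : contract b t = 0) => by
        simp [contract_add, ha, hb]
      smul_mem' := fun c a (ha : contract a t = 0) => by simp [contract_smul, ha] }
  have hle : stableSpan (raising d) φ ≤ K := by
    refine stableSpan_le h0 ?_
    rintro F ⟨i, j, hij, rfl⟩ ψ (hψ : contract ψ t = 0)
    have := lie_contract (e i j) ψ t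
    rw [hψ, ht i j hij, lie_zero, map_zero, zero_add] at this
    exact this.symm
  rw [hφ] at hle
  exact ht0 (eq_zero_of_forall_contract fun ψ => hle (Submodule.mem_top (x := ψ)))

/-- The weight of a singular vector in a tensor product of irreducible modules is bounded
coordinatewise by the weight of the second factor plus the first coordinate of the weight of the
first factor. -/
lemma IsHighestWeightVector.weight_le_of_tensor [FiniteDimensional ℂ M] [FiniteDimensional ℂ N]
    [LieModule.IsIrreducible ℂ (gl d) M] [LieModule.IsIrreducible ℂ (gl d) N]
    {w w' u : Fin d → ℕ} {x : M} {y : N} {t : M ⊗[ℂ] N} (hx : IsHighestWeightVector w x)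
    (hy : IsHighestWeightVector w' y) (ht : IsHighestWeightVector u t)
    (o : Fin d) (ho : ∀ i, o ≤ i) (m : Fin d) : u m ≤ w' m + w o := by
  obtain ⟨φ, hφ0, hlow, hdiag⟩ := hy.exists_dual
  have hne : contract φ t ≠ 0 :=
    contract_ne_zero ht.1 ht.2.1 (stableSpan_raising_dual_eq_top hφ0 hlow hdiag)
  have hmem : contract φ t ∈ eig M (e m m) (u m - w' m) := by
    rw [LRGl.mem_eig, lie_contract, ht.2.2, hdiag, map_smul, contract_smul]
    module
  have := hx.re_eigenvalue_le o ho m ((Submodule.ne_bot_iff _).mpr ⟨_, hmem, hne⟩)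
  simp only [Complex.sub_re, Complex.natCast_re] at this
  rw [sub_le_iff_le_add'] at this
  exact_mod_cast this

lemma comm_lie (X : gl d) (t : M ⊗[ℂ] N) :
    TensorProduct.comm ℂ M N ⁅X, t⁆ = ⁅X, TensorProduct.comm ℂ M N t⁆ := by
  induction t using TensorProduct.induction_on with
  | zero => simp
  | tmul m n => simp [add_comm]
  | add s t hs ht => simp only [map_add, lie_add, hs, ht]

lemma IsHighestWeightVector.comm {u : Fin d → ℕ} {t : M ⊗[ℂ] N} (ht : IsHighestWeightVector u t) :
    IsHighestWeightVector u (TensorProduct.comm ℂ M N t) := by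
  refine ⟨by simpa using ht.1, fun i j hij => ?_, fun i => ?_⟩
  · rw [← comm_lie, ht.2.1 i j hij, map_zero]
  · rw [← comm_lie, ht.2.2, map_smul]

end Contraction

lemma IsHighestWeightVector.map {M N : Type*} [AddCommGroup M] [Module ℂ M]
    [LieRingModule (gl d) M] [AddCommGroup N] [Module ℂ N] [LieRingModule (gl d) N]
    [LieModule.IsIrreducible ℂ (gl d) M] {u : Fin d → ℕ} {x : M} (hx : IsHighestWeightVector u x)
    {f : M →ₗ⁅ℂ, gl d⁆ N} (hf : f ≠ 0) :
    IsHighestWeightVector u (f x) := by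
  refine ⟨fun h => ?_, fun i j hij => ?_, fun i => ?_⟩
  · rcases IsSimpleOrder.eq_bot_or_eq_top f.ker with hk | hk
    · have : x ∈ f.ker := LieModuleHom.mem_ker.mpr h
      rw [hk] at this
      exact hx.1 ((LieSubmodule.mem_bot x).mp this)
    · refine hf (LieModuleHom.ext fun y => ?_)
      have : y ∈ f.ker := hk ▸ LieSubmodule.mem_top y
      exact LieModuleHom.mem_ker.mp this
  · rw [← LieModuleHom.map_lie, hx.2.1 i j hij, map_zero]
  · rw [← LieModuleHom.map_lie, hx.2.2, map_smul]

end LRGl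

theorem mainTheorem11 {d : ℕ} (lam mu nu : LRGl.Part d)
    (h : ∃ m : Fin d,
      min (mu m + lam ⟨0, m.pos⟩) (lam m + mu ⟨0, m.pos⟩) < nu m) :
    LRGl.lrCoeff lam mu nu = 0 := by
  obtain ⟨m, hm⟩ := h
  have hsub : Subsingleton (LRGl.V nu →ₗ⁅ℂ, LRGl.gl d⁆ LRGl.V lam ⊗[ℂ] LRGl.V mu) := by
    refine subsingleton_of_forall_eq 0 fun f => ?_
    by_contra hf
    obtain ⟨x, hx⟩ := (LRGl.irrep lam).exists_highestWeightVector
    obtain ⟨y, hy⟩ := (LRGl.irrep mu).exists_highestWeightVector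
    obtain ⟨z, hz⟩ := (LRGl.irrep nu).exists_highestWeightVector
    have ht := LRGl.IsHighestWeightVector.map (M := LRGl.V nu) hz hf
    have ho : ∀ i : Fin d, (⟨0, m.pos⟩ : Fin d) ≤ i := fun i => Fin.le_def.mpr (Nat.zero_le _)
    have h1 := LRGl.IsHighestWeightVector.weight_le_of_tensor (M := LRGl.V lam) (N := LRGl.V mu)
      hx hy ht _ ho m
    have h2 := LRGl.IsHighestWeightVector.weight_le_of_tensor (M := LRGl.V mu) (N := LRGl.V lam)
      hy hx ht.comm _ ho m
    exact absurd hm (not_lt.mpr (le_min h1 h2))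
  exact Module.finrank_zero_of_subsingleton
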